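/- All graphs are finite and simple. A subgraph of a graph $H$ consists of a subset of the vertices of $H$ and a subset of the edges of $H$ on that set of vertices. A graph $G$ is called a unique subgraph of $H$ if $H$ contains exactly one subgraph isomorphic to $G$. For a graph $H$ on $n$ vertices let $$f(H) := \frac{\left|\{G : G \text{ is a unique subgraph of } H\}\right|}{2^{\binom{n}{2}}/n!},$$ where the graphs $G$ (with any number of vertices) are counted up to isomorphism, and let $f(n)$ be the maximum of $f(H)$ over all graphs $H$ on $n$ vertices. Then $$\lim_{n\to\infty} f(n) = 0.$$ -/

import Mathlib

open Filter Topology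

namespace UniqueSubgraph

/-- `G` is a unique subgraph of `H`: exactly one subgraph of `H` (a set of vertices together with
a set of edges of `H` on that set of vertices) is isomorphic to `G`. -/
def IsUniqueSubgraph {V W : Type*} (G : SimpleGraph V) (H : SimpleGraph W) : Prop :=
  ∃! S : H.Subgraph, Nonempty (G ≃g S.coe)

/-- Finite graphs, with vertex set `Fin k` for some `k`; every finite graph is isomorphic to one
of these. -/
abbrev FinGraph : Type := Σ k : ℕ, SimpleGraph (Fin k)

/-- The isomorphism relation on finite graphs. -/
def isoSetoid : Setoid FinGraph where
  r G G' := Nonempty (G.2 ≃g G'.2)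
  iseqv :=
    { refl := fun _ => ⟨SimpleGraph.Iso.refl⟩
      symm := fun ⟨e⟩ => ⟨e.symm⟩
      trans := fun ⟨e⟩ ⟨e'⟩ => ⟨e'.comp e⟩ }

/-- Isomorphism classes of finite graphs. -/
abbrev IsoClass : Type := Quotient isoSetoid

/-- The isomorphism classes of the unique subgraphs of `H`. -/
def uniqueClasses {W : Type*} (H : SimpleGraph W) : Set IsoClass :=
  {c | ∃ G : FinGraph, Quotient.mk isoSetoid G = c ∧ IsUniqueSubgraph G.2 H}

/-- A finite graph has only finitely many unique subgraphs up to isomorphism, so that counting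
them with `Set.ncard` is meaningful. -/
theorem uniqueClasses_finite {W : Type*} [Finite W] (H : SimpleGraph W) :
    (uniqueClasses H).Finite := by
  have key : ∀ c : uniqueClasses H, ∃ S : H.Subgraph, ∃ G : FinGraph,
      Quotient.mk isoSetoid G = c.1 ∧ Nonempty (G.2 ≃g S.coe) := by
    rintro ⟨c, G, hG, S, hS, -⟩
    exact ⟨S, G, hG, hS⟩
  choose S hS using key
  have hinj : Function.Injective S := by
    intro c c' h
    obtain ⟨G, hG, ⟨e⟩⟩ := hS c
    obtain ⟨G', hG', ⟨e'⟩⟩ := hS c'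
    rw [← h] at e'
    apply Subtype.ext
    rw [← hG, ← hG']
    exact Quotient.sound ⟨e'.symm.comp e⟩
  have : Finite (SimpleGraph.Subgraph H) := by
    refine Finite.of_injective
      (fun T : H.Subgraph => ((T.verts, T.Adj) : Set W × (W → W → Prop))) ?_
    intro T T' h
    simp only [Prod.mk.injEq] at h
    exact SimpleGraph.Subgraph.ext h.1 h.2
  exact Set.finite_coe_iff.mp (Finite.of_injective S hinj)

/-- The number of non-isomorphic unique subgraphs of an `n`-vertex graph `H`, divided by
`2 ^ (n choose 2) / n!`. -/
noncomputable def ratio {n : ℕ} (H : SimpleGraph (Fin n)) : ℝ :=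
  ((uniqueClasses H).ncard : ℝ) / ((2 : ℝ) ^ n.choose 2 / (n.factorial : ℝ))

/-- The maximum of `ratio H` over all graphs `H` on `n` vertices. -/
noncomputable def maxRatio (n : ℕ) : ℝ :=
  (Finset.univ : Finset (SimpleGraph (Fin n))).sup' Finset.univ_nonempty ratio

end UniqueSubgraph

/-!
Let `H` have `n` vertices, let `M = n.choose 2`, and let `K = Hᶜ` have `m` edges. Adding the
missing vertices as isolated ones turns a unique subgraph of `H` into a unique spanning subgraph,
and at most two unique subgraphs become the same (`ncard_uniqueClasses_le`). Almost all labelled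
graphs have only the trivial automorphism, even when graphs are counted with the number of their
automorphisms (`sum_card_automorphism_le`). Hence, up to a factor `2` and a term `o(1)`, the ratio
for `H` is at most the probability that a uniformly random labelled graph `Y` has exactly one
embedding into `H` (`factorial_mul_card_isUniqueSpanning_le`); in terms of `Z = Yᶜ`, that the
random graph `Z` contains exactly one of the `n!` labelled copies of `K`. This probability tends
to `0` uniformly in `K`, for one of two reasons.

* If `Z` contains exactly one copy of `K`, then each of its `m` edges is pivotal for the monotone
  property of containing a copy. The total influence of a monotone property `F` is
  `∑ Z ∈ F, (2 * #Z - M)`, which is at most `2 ^ M * √M` since `#Z` has standard deviation `√M / 2`.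
  So the probability is at most `√M / m ≤ n / m` (`mul_card_unique_copy_le`), which is small if
  `m ≥ C * n` with a large constant `C`.
* If `m ≤ C * n`, then at least half of the vertices have degree at most `4 * C`. By the sunflower
  lemma for their closed neighbourhoods (`exists_sunflower`), about `(log n) ^ 2` of them form an
  independent set in which all pairs have the same common neighbours. Swapping two of these vertices
  in a copy of `K` yields another copy as soon as boundedly many further edges are present, and
  these sets of edges are disjoint for different pairs. For given positions of these vertices and
  their neighbours, no swap succeeds with probability `exp (-Ω((log n) ^ 4))` only, while there are
  `exp (O((log n) ^ 3))` such positions (`card_unique_copy_le_of_sparse`).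
-/

namespace UniqueSubgraph

/-! ### Set systems -/

section SetSystems

variable {α : Type*} [DecidableEq α]

/-- A form of the sunflower lemma for indexed families: many sets of size at most `D` contain `t`
among which all pairwise intersections lie in all the sets. -/
theorem exists_sunflower {ι : Type*} [DecidableEq ι] (t : ℕ) (ht : 1 ≤ t) (D : ℕ) :
    ∀ (F : ι → Finset α) (S : Finset ι), (∀ u ∈ S, (F u).card ≤ D) →
      (t * (D + 2)) ^ (D + 1) ≤ S.card →
      ∃ T ⊆ S, T.card = t ∧ ∀ u ∈ T, ∀ v ∈ T, ∀ w ∈ T, v ≠ w → F v ∩ F w ⊆ F u := by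
  induction D with
  | zero =>
    intro F S hF hS
    obtain ⟨T, hTS, hT⟩ := Finset.exists_subset_card_eq (s := S) (n := t) (by simp at hS; omega)
    refine ⟨T, hTS, hT, fun u _ v hv w _ _ => ?_⟩
    have : F v = ∅ := by simpa using hF v (hTS hv)
    simp [this]
  | succ D ih =>
    intro F S hF hS
    obtain ⟨T, hT, hmax⟩ := Finset.exists_max_image
      (S.powerset.filter fun T => ∀ v ∈ T, ∀ w ∈ T, v ≠ w → Disjoint (F v) (F w))
      Finset.card ⟨∅, by simp⟩
    simp only [Finset.mem_filter, Finset.mem_powerset] at hT hmax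
    obtain ⟨hTS, hT⟩ := hT
    rcases le_or_gt t T.card with htT | htT
    · obtain ⟨T', hT'T, hT'⟩ := Finset.exists_subset_card_eq htT
      refine ⟨T', hT'T.trans hTS, hT', fun u _ v hv w hw hvw => ?_⟩
      rw [Finset.disjoint_iff_inter_eq_empty.1 (hT v (hT'T hv) w (hT'T hw) hvw)]
      simp
    · set X := T.biUnion F with hX
      have hXcard : X.card ≤ t * (D + 1) :=
        (Finset.card_biUnion_le_card_mul _ _ (D + 1) fun u hu => hF u (hTS hu)).trans
          (Nat.mul_le_mul_right _ htT.le)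
      have hmeet : ∀ u ∈ S \ T, ∃ x ∈ X, x ∈ F u := by
        intro u hu
        rw [Finset.mem_sdiff] at hu
        by_contra! hno
        have hdis : ∀ v ∈ T, Disjoint (F u) (F v) := fun v hv =>
          Finset.disjoint_left.2 fun x hxu hxv => hno x (Finset.mem_biUnion.2 ⟨v, hv, hxv⟩) hxu
        have := hmax (insert u T) ⟨Finset.insert_subset hu.1 hTS, by
          intro v hv w hw hvw
          rw [Finset.mem_insert] at hv hw
          rcases hv with rfl | hv <;> rcases hw with rfl | hw
          · exact absurd rfl hvw
          · exact hdis w hw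
          · exact (hdis v hv).symm
          · exact hT v hv w hw hvw⟩
        rw [Finset.card_insert_of_notMem hu.2] at this
        omega
      set b := (t * (D + 2)) ^ (D + 1) with hb
      have hb1 : 1 ≤ b := Nat.one_le_pow _ _ (by positivity)
      have hbig : t * (D + 1) * b + t ≤ S.card := by
        calc t * (D + 1) * b + t ≤ t * (D + 1 + 2) * b := by nlinarith
          _ ≤ t * (D + 1 + 2) * (t * (D + 1 + 2)) ^ (D + 1) :=
            Nat.mul_le_mul_left _ (Nat.pow_le_pow_left (Nat.mul_le_mul_left _ (by omega)) _)
          _ = (t * (D + 1 + 2)) ^ (D + 1 + 1) := by rw [pow_succ' _ (D + 1)]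
          _ ≤ S.card := hS
      have hsd : t * (D + 1) * b < (S \ T).card := by
        have := Finset.card_sdiff_add_card_eq_card hTS
        omega
      -- Some element of `X` lies in many sets; it belongs to the core of the sunflower.
      obtain ⟨x, hx, hxb⟩ : ∃ x ∈ X, b ≤ ((S \ T).filter fun u => x ∈ F u).card := by
        by_contra! hno
        have h1 : S \ T ⊆ X.biUnion fun x => (S \ T).filter fun u => x ∈ F u := by
          intro u hu
          obtain ⟨x, hx, hxu⟩ := hmeet u hu
          exact Finset.mem_biUnion.2 ⟨x, hx, Finset.mem_filter.2 ⟨hu, hxu⟩⟩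
        have h2 := (Finset.card_le_card h1).trans
          (Finset.card_biUnion_le_card_mul _ _ b fun x hx => (hno x hx).le)
        have h3 := Nat.mul_le_mul_right b hXcard
        omega
      obtain ⟨T', hT'S, hT'c, hT'⟩ := ih (fun u => (F u).erase x) _ (fun u hu => by
        rw [Finset.mem_filter, Finset.mem_sdiff] at hu
        rw [Finset.card_erase_of_mem hu.2]
        have := hF u hu.1.1
        omega) hxb
      refine ⟨T', fun u hu => ?_, hT'c, fun u hu v hv w hw hvw y hy => ?_⟩
      · exact (Finset.mem_sdiff.1 (Finset.mem_filter.1 (hT'S hu)).1).1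
      · rw [Finset.mem_inter] at hy
        by_cases hyx : y = x
        · rw [hyx]
          exact (Finset.mem_filter.1 (hT'S hu)).2
        · exact Finset.mem_of_mem_erase (hT' u hu v hv w hw hvw
            (Finset.mem_inter.2 ⟨Finset.mem_erase.2 ⟨hyx, hy.1⟩, Finset.mem_erase.2 ⟨hyx, hy.2⟩⟩))

/-- The variance of the size of a random subset. -/
theorem sum_powerset_sq (s : Finset α) :
    ∑ Y ∈ s.powerset, (2 * (Y.card : ℝ) - s.card) ^ 2 = 2 ^ s.card * (s.card : ℝ) := by
  induction s using Finset.induction_on with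
  | empty => simp
  | insert a s ha ih =>
    have h : ∀ Y ∈ s.powerset, (2 * ((insert a Y).card : ℝ) - (insert a s).card) ^ 2 =
        2 * (2 * (Y.card : ℝ) - s.card) ^ 2 + 2 - (2 * (Y.card : ℝ) - (insert a s).card) ^ 2 := by
      intro Y hY
      have haY : a ∉ Y := fun h => ha (Finset.mem_powerset.1 hY h)
      rw [Finset.card_insert_of_notMem haY, Finset.card_insert_of_notMem ha]
      push_cast
      ring
    rw [Finset.sum_powerset_insert ha, Finset.sum_congr rfl h, Finset.sum_sub_distrib,
      Finset.sum_add_distrib, ← Finset.mul_sum, ih, Finset.card_insert_of_notMem ha]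
    simp only [Finset.sum_const, Finset.card_powerset, nsmul_eq_mul]
    push_cast
    ring

variable [Fintype α]

/-- The edge boundary of an up-set `F` in the Boolean cube: the edges inside `F` cancel in
`∑ Y ∈ F, (#Y - #Yᶜ)`. -/
theorem sum_card_pivotal (F : Finset (Finset α)) (hF : ∀ Y ∈ F, ∀ Z, Y ⊆ Z → Z ∈ F) :
    ∑ Y ∈ F, ((Y.filter fun e => Y.erase e ∉ F).card : ℤ) =
      ∑ Y ∈ F, (2 * (Y.card : ℤ) - Fintype.card α) := by
  have h1 : ∑ Y ∈ F, (Y.filter fun e => Y.erase e ∈ F).card = ∑ Y ∈ F, Yᶜ.card := by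
    rw [← Finset.card_sigma, ← Finset.card_sigma]
    refine Finset.card_bij' (fun p _ => ⟨p.1.erase p.2, p.2⟩) (fun p _ => ⟨insert p.2 p.1, p.2⟩)
      ?_ ?_ ?_ ?_
    · rintro ⟨Y, e⟩ h
      simp only [Finset.mem_sigma, Finset.mem_filter] at h
      simp [h.2.2]
    · rintro ⟨Y, e⟩ h
      simp only [Finset.mem_sigma, Finset.mem_compl] at h
      simp only [Finset.mem_sigma, Finset.mem_filter, Finset.mem_insert_self,
        Finset.erase_insert h.2, h.1, and_true]
      exact hF _ h.1 _ (Finset.subset_insert _ _)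
    · rintro ⟨Y, e⟩ h
      simp only [Finset.mem_sigma, Finset.mem_filter] at h
      simp [Finset.insert_erase h.2.1]
    · rintro ⟨Y, e⟩ h
      simp only [Finset.mem_sigma, Finset.mem_compl] at h
      simp [Finset.erase_insert h.2]
  have h2 : ∀ Y ∈ F, ((Y.filter fun e => Y.erase e ∉ F).card : ℤ) =
      Y.card - ((Y.filter fun e => Y.erase e ∈ F).card : ℤ) := by
    intro Y _
    have := Finset.card_filter_add_card_filter_not (s := Y) (fun e => Y.erase e ∈ F)
    push_cast [← this]
    ring
  rw [Finset.sum_congr rfl h2, Finset.sum_sub_distrib,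
    ← Nat.cast_sum F (fun Y => (Y.filter fun e => Y.erase e ∈ F).card),
    h1, Nat.cast_sum, ← Finset.sum_sub_distrib]
  refine Finset.sum_congr rfl fun Y _ => ?_
  rw [Finset.card_compl, Nat.cast_sub (Finset.card_le_univ Y)]
  ring

/-- The mean absolute deviation of the size of a random subset is at most its standard deviation, by
the Cauchy-Schwarz inequality. -/
theorem sum_abs_le :
    ∑ Y : Finset α, |2 * (Y.card : ℝ) - Fintype.card α| ≤
      2 ^ Fintype.card α * √(Fintype.card α) := by
  have h := sum_powerset_sq (Finset.univ : Finset α)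
  rw [Finset.powerset_univ, Finset.card_univ] at h
  have h2 := Finset.sum_mul_sq_le_sq_mul_sq (Finset.univ : Finset (Finset α)) (fun _ => (1 : ℝ))
    (fun Y => |2 * (Y.card : ℝ) - Fintype.card α|)
  simp only [one_mul, one_pow, sq_abs, h, Finset.sum_const, Finset.card_univ, Fintype.card_finset,
    nsmul_eq_mul, mul_one] at h2
  refine abs_le_of_sq_le_sq' ?_ (by positivity) |>.2
  rw [mul_pow, Real.sq_sqrt (by positivity)]
  push_cast at h2
  nlinarith [h2]

open Classical in
/-- Removing an element of the unique member of `𝓚` contained in `Y` destroys the property of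
containing a member of `𝓚`; so such `Y` have many pivotal elements, and the total influence of an
up-set is at most that of the majority function. -/
theorem mul_card_existsUnique_subset_le (𝓚 : Finset (Finset α)) (m : ℕ)
    (hm : ∀ K ∈ 𝓚, m ≤ K.card) :
    (m : ℝ) * (Finset.univ.filter fun Y : Finset α => ∃! K, K ∈ 𝓚 ∧ K ⊆ Y).card ≤
      2 ^ Fintype.card α * √(Fintype.card α) := by
  set F : Finset (Finset α) := Finset.univ.filter fun Y => ∃ K ∈ 𝓚, K ⊆ Y with hFdef
  have hF : ∀ Y ∈ F, ∀ Z, Y ⊆ Z → Z ∈ F := by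
    intro Y hY Z hYZ
    simp only [hFdef, Finset.mem_filter, Finset.mem_univ, true_and] at hY ⊢
    obtain ⟨K, hK, hKY⟩ := hY
    exact ⟨K, hK, hKY.trans hYZ⟩
  set A := Finset.univ.filter fun Y : Finset α => ∃! K, K ∈ 𝓚 ∧ K ⊆ Y with hA
  have hAF : A ⊆ F := by
    intro Y hY
    simp only [hA, hFdef, Finset.mem_filter, Finset.mem_univ, true_and] at hY ⊢
    exact hY.exists
  have h1 : ∀ Y ∈ A, (m : ℝ) ≤ ((Y.filter fun e => Y.erase e ∉ F).card : ℝ) := by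
    intro Y hY
    simp only [hA, Finset.mem_filter, Finset.mem_univ, true_and] at hY
    obtain ⟨K, ⟨hK, hKY⟩, hu⟩ := hY
    refine Nat.cast_le.2 ((hm K hK).trans (Finset.card_le_card ?_))
    intro e he
    simp only [hFdef, Finset.mem_filter, Finset.mem_univ, true_and, not_exists, not_and]
    refine ⟨hKY he, fun L hL hLY => ?_⟩
    have hLK : L = K := hu L ⟨hL, hLY.trans (Finset.erase_subset _ _)⟩
    exact Finset.notMem_erase e Y (hLY (hLK ▸ he))
  have h2 := congrArg (Int.cast : ℤ → ℝ) (sum_card_pivotal F hF)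
  push_cast at h2
  calc (m : ℝ) * A.card = ∑ _Y ∈ A, (m : ℝ) := by simp [mul_comm]
    _ ≤ ∑ Y ∈ A, ((Y.filter fun e => Y.erase e ∉ F).card : ℝ) := Finset.sum_le_sum h1
    _ ≤ ∑ Y ∈ F, ((Y.filter fun e => Y.erase e ∉ F).card : ℝ) :=
        Finset.sum_le_sum_of_subset_of_nonneg hAF fun _ _ _ => by positivity
    _ = ∑ Y ∈ F, (2 * (Y.card : ℝ) - Fintype.card α) := h2
    _ ≤ ∑ Y ∈ F, |2 * (Y.card : ℝ) - Fintype.card α| := Finset.sum_le_sum fun _ _ => le_abs_self _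
    _ ≤ ∑ Y : Finset α, |2 * (Y.card : ℝ) - Fintype.card α| :=
        Finset.sum_le_sum_of_subset_of_nonneg (Finset.subset_univ _) fun _ _ _ => abs_nonneg _
    _ ≤ _ := sum_abs_le

open Classical in
/-- For disjoint sets `Q i` with at most `d` elements, the events `Q i ⊆ Y` are independent and
have probability at least `2⁻ᵈ` each. -/
theorem card_forall_not_subset_le {ι : Type*} (I : Finset ι) (Q : ι → Finset α) (d : ℕ)
    (hd : ∀ i ∈ I, (Q i).card ≤ d)
    (hdisj : ∀ i ∈ I, ∀ j ∈ I, i ≠ j → Disjoint (Q i) (Q j)) :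
    ((Finset.univ.filter fun Y : Finset α => ∀ i ∈ I, ¬ Q i ⊆ Y).card : ℝ) ≤
      2 ^ Fintype.card α * (1 - (1 / 2) ^ d) ^ I.card := by
  induction I using Finset.induction_on with
  | empty => simp
  | insert j I hj ih =>
    set B := Finset.univ.filter fun Y : Finset α => ∀ i ∈ I, ¬ Q i ⊆ Y with hB
    have ih' := ih (fun i hi => hd i (Finset.mem_insert_of_mem hi))
      (fun i hi k hk => hdisj i (Finset.mem_insert_of_mem hi) k (Finset.mem_insert_of_mem hk))
    have hsplit := Finset.card_filter_add_card_filter_not (s := B) (fun Y => Q j ⊆ Y)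
    have heq : (Finset.univ.filter fun Y : Finset α => ∀ i ∈ insert j I, ¬ Q i ⊆ Y) =
        B.filter fun Y => ¬ Q j ⊆ Y := by
      ext Y
      simp [hB, and_comm]
    -- `Y` is recovered from `Y ∪ Q j` and `Y ∩ Q j`.
    have hle : B.card ≤ (B.filter fun Y => Q j ⊆ Y).card * 2 ^ d := by
      calc B.card ≤ ((B.filter fun Y => Q j ⊆ Y) ×ˢ (Q j).powerset).card := by
            refine Finset.card_le_card_of_injOn (fun Y => (Y ∪ Q j, Y ∩ Q j)) ?_ ?_
            · intro Y hY
              simp only [hB, Finset.coe_filter, Finset.mem_univ, true_and, Set.mem_ofPred_eq] at hY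
              simp only [Finset.mem_coe, Finset.mem_product, Finset.mem_filter, hB,
                Finset.mem_univ, true_and, Finset.mem_powerset, Finset.inter_subset_right,
                Finset.subset_union_right, and_true]
              intro i hi hsub
              have hij : i ≠ j := fun h => hj (h ▸ hi)
              exact hY i hi ((hdisj i (Finset.mem_insert_of_mem hi) j
                (Finset.mem_insert_self _ _) hij).left_le_of_le_sup_right hsub)
            · intro Y _ Z _ h
              simp only [Prod.mk.injEq] at h
              ext e
              have h1 := Finset.ext_iff.1 h.1 e
              have h2 := Finset.ext_iff.1 h.2 e
              simp only [Finset.mem_union, Finset.mem_inter] at h1 h2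
              tauto
        _ ≤ _ := by
            rw [Finset.card_product, Finset.card_powerset]
            exact Nat.mul_le_mul_left _ (Nat.pow_le_pow_right (by norm_num)
              (hd j (Finset.mem_insert_self _ _)))
    rw [heq, Finset.card_insert_of_notMem hj]
    have hle' : (B.card : ℝ) * (1 / 2) ^ d ≤ (B.filter fun Y => Q j ⊆ Y).card := by
      have : (B.card : ℝ) ≤ (B.filter fun Y => Q j ⊆ Y).card * 2 ^ d := by exact_mod_cast hle
      rw [one_div, inv_pow, ← div_eq_mul_inv, div_le_iff₀ (by positivity)]
      exact this
    have hs' : ((B.filter fun Y => Q j ⊆ Y).card : ℝ) + (B.filter fun Y => ¬ Q j ⊆ Y).card =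
        B.card := by exact_mod_cast hsplit
    have hnn : (0 : ℝ) ≤ 1 - (1 / 2) ^ d := by
      have : ((1 : ℝ) / 2) ^ d ≤ 1 := pow_le_one₀ (by norm_num) (by norm_num)
      linarith
    have := mul_le_mul_of_nonneg_right ih' hnn
    rw [pow_succ]
    nlinarith [this]

/-- A subset invariant under `g` is determined by its trace on the complement of any `D` with
`g '' D` disjoint from `D`. -/
theorem card_invariant_mul_le (g : Equiv.Perm α) (D : Finset α) (hD : ∀ e ∈ D, g e ∉ D) :
    (Finset.univ.filter fun Y : Finset α => ∀ e, g e ∈ Y ↔ e ∈ Y).card * 2 ^ D.card ≤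
      2 ^ Fintype.card α := by
  have h : (Finset.univ.filter fun Y : Finset α => ∀ e, g e ∈ Y ↔ e ∈ Y).card ≤
      Dᶜ.powerset.card := by
    refine Finset.card_le_card_of_injOn (fun Y => Y \ D) ?_ ?_
    · intro Y _
      simp only [Finset.mem_coe, Finset.mem_powerset]
      intro e he
      simpa using (Finset.mem_sdiff.1 he).2
    · intro Y hY Z hZ h
      simp only [Finset.coe_filter, Finset.mem_univ, true_and, Set.mem_ofPred_eq] at hY hZ
      have h' : ∀ e ∉ D, (e ∈ Y ↔ e ∈ Z) := by
        intro e he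
        have := Finset.ext_iff.1 h e
        simpa [he] using this
      ext e
      by_cases he : e ∈ D
      · rw [← hY, ← hZ]
        exact h' _ (hD e he)
      · exact h' e he
  calc _ ≤ Dᶜ.powerset.card * 2 ^ D.card := Nat.mul_le_mul_right _ h
    _ = 2 ^ Fintype.card α := by
      rw [Finset.card_powerset, ← pow_add, Finset.card_compl_add_card]

/-- A third of the points moved by a permutation can be chosen such that none of them is mapped to
another one. -/
theorem exists_disjoint_image (g : Equiv.Perm α) :
    ∃ D : Finset α, (∀ e ∈ D, g e ∉ D) ∧ g.support.card ≤ 3 * D.card := by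
  obtain ⟨D, hD, hmax⟩ := Finset.exists_max_image
    (Finset.univ.filter fun D : Finset α => ∀ e ∈ D, g e ∉ D) Finset.card ⟨∅, by simp⟩
  simp only [Finset.mem_filter, Finset.mem_univ, true_and] at hD hmax
  refine ⟨D, hD, ?_⟩
  -- By maximality, every moved point is in `D` or is mapped to or from `D`.
  have hsub : g.support ⊆ (D ∪ D.image g) ∪ D.image g.symm := by
    intro e he
    rw [Equiv.Perm.mem_support] at he
    by_contra hne
    simp only [Finset.mem_union, Finset.mem_image, not_or, not_exists, not_and] at hne
    obtain ⟨⟨h1, h2⟩, h3⟩ := hne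
    have := hmax (insert e D) (by
      intro x hx
      rw [Finset.mem_insert] at hx ⊢
      rintro (h | h)
      · rcases hx with rfl | hx
        · exact he h
        · exact h2 x hx h
      · rcases hx with rfl | hx
        · exact h3 _ h (by simp)
        · exact hD x hx h)
    rw [Finset.card_insert_of_notMem h1] at this
    omega
  calc g.support.card ≤ _ := Finset.card_le_card hsub
    _ ≤ (D.card + D.card) + D.card := by
      refine (Finset.card_union_le _ _).trans (add_le_add ((Finset.card_union_le _ _).trans
        (add_le_add le_rfl Finset.card_image_le)) Finset.card_image_le)
    _ = _ := by ring

end SetSystems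

/-! ### Labelled graphs as points of the Boolean cube, and their automorphisms -/

section LabelledGraphs

variable {V : Type*}

/-- The possible edges of a simple graph on `V`. -/
abbrev Edge (V : Type*) : Type _ := {e : Sym2 V // ¬ e.IsDiag}

/-- The action of a permutation of the vertices on the possible edges. -/
def edgePerm (σ : Equiv.Perm V) : Equiv.Perm (Edge V) where
  toFun e := ⟨Sym2.map σ e.1, by rw [Sym2.isDiag_map σ.injective]; exact e.2⟩
  invFun e := ⟨Sym2.map σ.symm e.1, by rw [Sym2.isDiag_map σ.symm.injective]; exact e.2⟩
  left_inv e := by ext1; simp [Sym2.map_map]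
  right_inv e := by ext1; simp [Sym2.map_map]

@[simp] theorem coe_edgePerm (σ : Equiv.Perm V) (e : Edge V) :
    (edgePerm σ e).1 = Sym2.map σ e.1 := rfl

@[simp] theorem edgePerm_symm_edgePerm (σ : Equiv.Perm V) (e : Edge V) :
    edgePerm σ.symm (edgePerm σ e) = e := (edgePerm σ).left_inv e

variable [Fintype V] [DecidableEq V]

theorem card_edge : Fintype.card (Edge V) = (Fintype.card V).choose 2 :=
  Sym2.card_subtype_not_diag

open Classical in
/-- The edge set of a graph, as an element of the Boolean cube of all finite sets of possible
edges. -/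
noncomputable def edges (G : SimpleGraph V) : Finset (Edge V) :=
  Finset.univ.filter fun e => e.1 ∈ G.edgeSet

@[simp] theorem mem_edges {G : SimpleGraph V} {e : Edge V} : e ∈ edges G ↔ e.1 ∈ G.edgeSet := by
  simp [edges]

theorem edges_subset_edges {G G' : SimpleGraph V} : edges G ⊆ edges G' ↔ G ≤ G' := by
  constructor
  · intro h a b hab
    have := @h ⟨s(a, b), by simpa using hab.ne⟩ (by simpa using hab)
    simpa using this
  · intro h e he
    rw [mem_edges] at he ⊢
    exact SimpleGraph.edgeSet_mono h he

theorem edges_injective : Function.Injective (edges : SimpleGraph V → Finset (Edge V)) :=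
  fun _ _ h => le_antisymm (edges_subset_edges.1 h.subset) (edges_subset_edges.1 h.symm.subset)

open Classical in
theorem card_edges (G : SimpleGraph V) : (edges G).card = G.edgeFinset.card := by
  rw [← Finset.card_map (Function.Embedding.subtype _)]
  congr 1
  ext e
  simp only [Finset.mem_map, mem_edges, Function.Embedding.subtype_apply, Subtype.exists,
    exists_and_right, exists_eq_right, SimpleGraph.mem_edgeFinset]
  exact ⟨fun h => h.2, fun h => ⟨G.not_isDiag_of_mem_edgeSet h, h⟩⟩

theorem edgePerm_mem_edges {σ : Equiv.Perm V} {G : SimpleGraph V} {e : Edge V} :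
    edgePerm σ e ∈ edges G ↔ e ∈ edges (G.comap σ) := by
  obtain ⟨e, he⟩ := e
  induction e using Sym2.ind with
  | _ a b => simp

theorem card_edges_comap (G : SimpleGraph V) (σ : Equiv.Perm V) :
    (edges (G.comap σ)).card = (edges G).card := by
  rw [← Finset.card_map (edgePerm σ).toEmbedding]
  congr 1
  ext e
  rw [Finset.mem_map_equiv, ← edgePerm_mem_edges, Equiv.apply_symm_apply]

/-- An edge with an end `x` moved by `π` is moved unless its other end is `π x`. -/
theorem card_support_mul_le (π : Equiv.Perm V) :
    π.support.card * (Fintype.card V - 2) ≤ 2 * (edgePerm π).support.card := by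
  classical
  set P := π.support.sigma fun x => (Finset.univ : Finset V) \ {x, π x} with hP
  have hPcard : π.support.card * (Fintype.card V - 2) ≤ P.card := by
    rw [hP, Finset.card_sigma, ← smul_eq_mul]
    refine Finset.card_nsmul_le_sum _ _ _ fun x _ => ?_
    have h1 := Finset.le_card_sdiff {x, π x} (Finset.univ : Finset V)
    have h2 : ({x, π x} : Finset V).card ≤ 2 := Finset.card_le_two
    rw [Finset.card_univ] at h1
    omega
  refine hPcard.trans ?_
  rw [← Finset.card_map (Function.Embedding.subtype _)]
  refine Finset.card_le_mul_card_image_of_maps_to (f := fun p => s(p.1, p.2)) ?_ 2 ?_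
  · rintro ⟨x, y⟩ hp
    simp only [hP, Finset.mem_sigma, Equiv.Perm.mem_support, Finset.mem_sdiff, Finset.mem_univ,
      Finset.mem_insert, Finset.mem_singleton, true_and, not_or] at hp
    simp only [Finset.mem_map, Function.Embedding.subtype_apply]
    refine ⟨⟨s(x, y), by simpa using fun h => hp.2.1 h.symm⟩, ?_, rfl⟩
    rw [Equiv.Perm.mem_support, Ne, Subtype.ext_iff, coe_edgePerm]
    simp only [Sym2.map_mk, Sym2.eq_iff]
    rintro (⟨h, -⟩ | ⟨h, -⟩)
    · exact hp.1 h
    · exact hp.2.2 h.symm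
  · intro e _
    induction e using Sym2.ind with
    | _ a b =>
      refine (Finset.card_le_card (t := {⟨a, b⟩, ⟨b, a⟩}) ?_).trans Finset.card_le_two
      rintro ⟨x, y⟩ hp
      have := (Finset.mem_filter.1 hp).2
      simp only [Sym2.eq_iff] at this
      rcases this with ⟨rfl, rfl⟩ | ⟨rfl, rfl⟩ <;> simp

open Classical in
/-- A permutation moving `k` vertices moves at least `k * (n - 2) / 2` possible edges. A third of
these are determined by the others in every graph it fixes. -/
theorem card_comap_eq_self_le (π : Equiv.Perm V) :
    ((Finset.univ.filter fun X : SimpleGraph V => X.comap π = X).card : ℝ) ≤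
      2 ^ (Fintype.card V).choose 2 *
        ((2 : ℝ) ^ (-(((Fintype.card V - 2 : ℕ) : ℝ) / 6))) ^ π.support.card := by
  obtain ⟨D, hD, hcard⟩ := exists_disjoint_image (edgePerm π)
  have h1 := card_invariant_mul_le (edgePerm π) D hD
  have h2 : (Finset.univ.filter fun X : SimpleGraph V => X.comap π = X).card ≤
      (Finset.univ.filter fun Y : Finset (Edge V) => ∀ e, edgePerm π e ∈ Y ↔ e ∈ Y).card := by
    refine Finset.card_le_card_of_injOn edges ?_ edges_injective.injOn
    intro X hX
    simp only [Finset.coe_filter, Finset.mem_univ, true_and, Set.mem_ofPred_eq] at hX ⊢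
    intro e
    rw [edgePerm_mem_edges, hX]
  have h3 : ((Finset.univ.filter fun X : SimpleGraph V => X.comap π = X).card : ℝ) *
      2 ^ D.card ≤ 2 ^ (Fintype.card V).choose 2 := by
    rw [card_edge] at h1
    exact_mod_cast (Nat.mul_le_mul_right _ h2).trans h1
  have h4 : (1 : ℝ) ≤ 2 ^ D.card *
      ((2 : ℝ) ^ (-(((Fintype.card V - 2 : ℕ) : ℝ) / 6))) ^ π.support.card := by
    rw [← Real.rpow_natCast 2 D.card, ← Real.rpow_mul_natCast (by norm_num),
      ← Real.rpow_add (by norm_num)]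
    refine Real.one_le_rpow (by norm_num) ?_
    have h5 : ((π.support.card * (Fintype.card V - 2) : ℕ) : ℝ) ≤ ((6 * D.card : ℕ) : ℝ) := by
      refine Nat.cast_le.2 ((card_support_mul_le π).trans ?_)
      omega
    push_cast at h5
    linarith
  set q := (2 : ℝ) ^ (-(((Fintype.card V - 2 : ℕ) : ℝ) / 6))
  have hq : 0 ≤ q ^ π.support.card := by positivity
  calc _ ≤ ((Finset.univ.filter fun X : SimpleGraph V => X.comap π = X).card : ℝ) *
        (2 ^ D.card * q ^ π.support.card) := le_mul_of_one_le_right (by positivity) h4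
    _ ≤ _ := by
      rw [← mul_assoc]
      exact mul_le_mul_of_nonneg_right h3 hq

/-- Extending the sum from permutations to all maps `V → V` turns it into a product. -/
theorem sum_perm_pow_support_le (q : ℝ) (hq : 0 ≤ q) :
    ∑ π : Equiv.Perm V, q ^ π.support.card ≤
      (1 + Fintype.card V * q) ^ Fintype.card V := by
  have h1 : ∀ π : Equiv.Perm V, q ^ π.support.card = ∏ x, if π x = x then 1 else q := by
    intro π
    rw [Finset.prod_ite, Finset.prod_const_one, one_mul, Finset.prod_const]
    rfl
  have h2 : ∑ f : V → V, ∏ x, (if f x = x then 1 else q) =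
      ∏ x : V, ∑ y : V, (if y = x then 1 else q) := by
    rw [Finset.prod_univ_sum, Fintype.piFinset_univ]
  calc ∑ π : Equiv.Perm V, q ^ π.support.card
      = ∑ π : Equiv.Perm V, ∏ x, (if (π : V → V) x = x then 1 else q) :=
        Finset.sum_congr rfl fun π _ => h1 π
    _ = ∑ f ∈ (Finset.univ : Finset (Equiv.Perm V)).image (fun π : Equiv.Perm V => (π : V → V)),
          ∏ x, (if f x = x then 1 else q) :=
        (Finset.sum_image (f := fun f : V → V => ∏ x, if f x = x then 1 else q)
          fun (π : Equiv.Perm V) _ π' _ h => Equiv.coe_fn_injective h).symm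
    _ ≤ ∑ f : V → V, ∏ x, (if f x = x then 1 else q) := by
        refine Finset.sum_le_sum_of_subset_of_nonneg (Finset.subset_univ _) fun f _ _ => ?_
        exact Finset.prod_nonneg fun x _ => by split_ifs <;> simp [hq]
    _ = ∏ x : V, ∑ y : V, (if y = x then 1 else q) := h2
    _ ≤ ∏ _x : V, (1 + Fintype.card V * q) := by
        refine Finset.prod_le_prod (fun x _ => Finset.sum_nonneg fun y _ => by
          split_ifs <;> simp [hq]) fun x _ => ?_
        calc ∑ y : V, (if y = x then 1 else q) ≤ ∑ y : V, ((if y = x then 1 else 0) + q) :=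
              Finset.sum_le_sum fun y _ => by split_ifs <;> simp [hq]
          _ = _ := by simp [Finset.sum_add_distrib]
    _ = _ := by simp

open Classical in
/-- The number of pairs of a labelled graph and a nontrivial automorphism of it. -/
theorem sum_card_automorphism_le :
    ∑ π ∈ (Finset.univ : Finset (Equiv.Perm V)).erase 1,
      ((Finset.univ.filter fun X : SimpleGraph V => X.comap π = X).card : ℝ) ≤
      2 ^ (Fintype.card V).choose 2 * ((1 + Fintype.card V *
        (2 : ℝ) ^ (-(((Fintype.card V - 2 : ℕ) : ℝ) / 6))) ^ Fintype.card V - 1) := by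
  set q := (2 : ℝ) ^ (-(((Fintype.card V - 2 : ℕ) : ℝ) / 6)) with hq
  have h := sum_perm_pow_support_le (V := V) q (by positivity)
  rw [← Finset.add_sum_erase _ _ (Finset.mem_univ (1 : Equiv.Perm V))] at h
  simp only [Equiv.Perm.support_one, Finset.card_empty, pow_zero] at h
  calc _ ≤ ∑ π ∈ (Finset.univ : Finset (Equiv.Perm V)).erase 1,
        2 ^ (Fintype.card V).choose 2 * q ^ π.support.card :=
        Finset.sum_le_sum fun π _ => card_comap_eq_self_le π
    _ ≤ _ := by
        rw [← Finset.mul_sum]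
        exact mul_le_mul_of_nonneg_left (by linarith) (by positivity)

open Classical in
/-- The influence bound for the copies of `K`, which all have the same number of edges. -/
theorem mul_card_unique_copy_le (K : SimpleGraph V) :
    ((edges K).card : ℝ) *
      (Finset.univ.filter fun Z : SimpleGraph V => ∃! σ : Equiv.Perm V, K.comap σ ≤ Z).card ≤
      2 ^ (Fintype.card V).choose 2 * √((Fintype.card V).choose 2) := by
  have h := mul_card_existsUnique_subset_le
    ((Finset.univ : Finset (Equiv.Perm V)).image fun σ : Equiv.Perm V => edges (K.comap σ))
    (edges K).card (by
      intro L hL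
      obtain ⟨σ, -, rfl⟩ := Finset.mem_image.1 hL
      exact (card_edges_comap K σ).ge)
  rw [card_edge] at h
  refine le_trans (mul_le_mul_of_nonneg_left (Nat.cast_le.2 ?_) (by positivity)) h
  refine Finset.card_le_card_of_injOn edges ?_ edges_injective.injOn
  intro Z hZ
  simp only [Finset.coe_filter, Finset.mem_univ, true_and, Set.mem_ofPred_eq] at hZ ⊢
  obtain ⟨σ, hσ, hu⟩ := hZ
  refine ⟨edges (K.comap σ), ⟨Finset.mem_image_of_mem _ (Finset.mem_univ _),
    edges_subset_edges.2 hσ⟩, ?_⟩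
  rintro L ⟨hL, hLZ⟩
  obtain ⟨τ, -, rfl⟩ := Finset.mem_image.1 hL
  rw [hu τ (edges_subset_edges.1 hLZ)]

end LabelledGraphs

/-! ### Unique copies of sparse graphs -/

section SparseCase

variable {V : Type*} [Fintype V] [DecidableEq V]

/-- The edges which a graph has to contain in addition to `K` for it to contain the copy of `K`
obtained by swapping `u` and `v`. -/
noncomputable def swapEdges (K : SimpleGraph V) (u v : V) : Finset (Edge V) :=
  edges (K.comap (Equiv.swap u v)) \ edges K

theorem exists_of_mem_swapEdges {K : SimpleGraph V} {u v : V} (huv : ¬ K.Adj u v) {e : Edge V}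
    (he : e ∈ swapEdges K u v) :
    ∃ x y w, (x = u ∧ y = v ∨ x = v ∧ y = u) ∧ K.Adj y w ∧ ¬ K.Adj x w ∧ e.1 = s(x, w) := by
  obtain ⟨e, hdiag⟩ := e
  induction e using Sym2.ind with
  | _ a b =>
    have hvu : ¬ K.Adj v u := fun h => huv h.symm
    simp only [swapEdges, Finset.mem_sdiff, mem_edges, SimpleGraph.mem_edgeSet,
      SimpleGraph.comap_adj] at he
    obtain ⟨h1, h2⟩ := he
    have h2' : ¬ K.Adj b a := fun h => h2 h.symm
    have h1' := h1.symm
    have key : ∀ a b : V, K.Adj (Equiv.swap u v a) (Equiv.swap u v b) → ¬ K.Adj a b →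
        (a = u ∨ a = v) → ∃ x y w, (x = u ∧ y = v ∨ x = v ∧ y = u) ∧ K.Adj y w ∧
          ¬ K.Adj x w ∧ s(a, b) = s(x, w) := by
      intro a b h1 h2 ha
      by_cases hbu : b = u
      · subst hbu
        rcases ha with rfl | rfl <;> simp_all
      by_cases hbv : b = v
      · subst hbv
        rcases ha with rfl | rfl <;> simp_all
      rw [Equiv.swap_apply_of_ne_of_ne hbu hbv] at h1
      rcases ha with rfl | rfl
      · rw [Equiv.swap_apply_left] at h1
        exact ⟨a, v, b, Or.inl ⟨rfl, rfl⟩, h1, h2, rfl⟩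
      · rw [Equiv.swap_apply_right] at h1
        exact ⟨a, u, b, Or.inr ⟨rfl, rfl⟩, h1, h2, rfl⟩
    by_cases ha : a = u ∨ a = v
    · exact key a b h1 h2 ha
    by_cases hb : b = u ∨ b = v
    · obtain ⟨x, y, w, h⟩ := key b a h1' h2' hb
      exact ⟨x, y, w, by simpa only [Sym2.eq_swap (a := a)] using h⟩
    push Not at ha hb
    rw [Equiv.swap_apply_of_ne_of_ne ha.1 ha.2, Equiv.swap_apply_of_ne_of_ne hb.1 hb.2] at h1
    exact absurd h1 h2

open Classical in
theorem card_swapEdges_le {K : SimpleGraph V} {u v : V} (huv : ¬ K.Adj u v) {D : ℕ}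
    (hu : K.degree u ≤ D) (hv : K.degree v ≤ D) : (swapEdges K u v).card ≤ 2 * D := by
  rw [← Finset.card_map (Function.Embedding.subtype _)]
  have hsub : (swapEdges K u v).map (Function.Embedding.subtype _) ⊆
      (K.neighborFinset v).image (fun w => s(u, w)) ∪
        (K.neighborFinset u).image (fun w => s(v, w)) := by
    intro e he'
    obtain ⟨e, he, rfl⟩ := Finset.mem_map.1 he'
    obtain ⟨x, y, w, hxy, hyw, -, hew⟩ := exists_of_mem_swapEdges huv he
    simp only [Function.Embedding.subtype_apply, hew, Finset.mem_union, Finset.mem_image,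
      SimpleGraph.mem_neighborFinset]
    rcases hxy with ⟨rfl, rfl⟩ | ⟨rfl, rfl⟩
    · exact Or.inl ⟨w, hyw, rfl⟩
    · exact Or.inr ⟨w, hyw, rfl⟩
  calc _ ≤ _ := Finset.card_le_card hsub
    _ ≤ K.degree v + K.degree u := (Finset.card_union_le _ _).trans
        (add_le_add Finset.card_image_le Finset.card_image_le)
    _ ≤ 2 * D := by omega

/-- If two disjoint sets span an independent set in which all common neighbourhoods of pairs
coincide, then different pairs of vertices have disjoint swap edges: an edge in `swapEdges K u v`
joins one of `u`, `v` to a vertex which, within the independent set, is adjacent only to the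
other one. -/
theorem disjoint_swapEdges {K : SimpleGraph V} {T₁ T₂ : Finset V} (hT : Disjoint T₁ T₂)
    (hind : ∀ u ∈ T₁ ∪ T₂, ∀ v ∈ T₁ ∪ T₂, ¬ K.Adj u v)
    (hsun : ∀ u ∈ T₁ ∪ T₂, ∀ v ∈ T₁ ∪ T₂, ∀ w ∈ T₁ ∪ T₂, v ≠ w →
      ∀ x, K.Adj v x → K.Adj w x → K.Adj u x)
    {p p' : V × V} (hp : p ∈ T₁ ×ˢ T₂) (hp' : p' ∈ T₁ ×ˢ T₂) (hne : p ≠ p') :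
    Disjoint (swapEdges K p.1 p.2) (swapEdges K p'.1 p'.2) := by
  obtain ⟨u, v⟩ := p
  obtain ⟨u', v'⟩ := p'
  simp only [Finset.mem_product] at hp hp'
  have hu := Finset.mem_union_left T₂ hp.1
  have hv := Finset.mem_union_right T₁ hp.2
  have hu' := Finset.mem_union_left T₂ hp'.1
  have hv' := Finset.mem_union_right T₁ hp'.2
  rw [Finset.disjoint_left]
  intro e he he'
  obtain ⟨x, y, w, hxy, hyw, hxw, hew⟩ := exists_of_mem_swapEdges (hind u hu v hv) he
  obtain ⟨x', y', w', hxy', hyw', hxw', hew'⟩ :=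
    exists_of_mem_swapEdges (hind u' hu' v' hv') he'
  have hx : x ∈ T₁ ∪ T₂ ∧ y ∈ T₁ ∪ T₂ := by
    rcases hxy with ⟨rfl, rfl⟩ | ⟨rfl, rfl⟩
    exacts [⟨hu, hv⟩, ⟨hv, hu⟩]
  have hx' : x' ∈ T₁ ∪ T₂ ∧ y' ∈ T₁ ∪ T₂ := by
    rcases hxy' with ⟨rfl, rfl⟩ | ⟨rfl, rfl⟩
    exacts [⟨hu', hv'⟩, ⟨hv', hu'⟩]
  have hw : w ∉ T₁ ∪ T₂ := fun h => hind y hx.2 w h hyw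
  rw [hew, Sym2.eq_iff] at hew'
  rcases hew' with ⟨rfl, rfl⟩ | ⟨-, rfl⟩
  · have hyy : y = y' := by
      by_contra h
      exact hxw (hsun x hx.1 y hx.2 y' hx'.2 h w hyw hyw')
    subst hyy
    have hd : ∀ a ∈ T₁, a ∉ T₂ := fun _ => (Finset.disjoint_left.1 hT ·)
    apply hne
    rcases hxy with ⟨rfl, rfl⟩ | ⟨rfl, rfl⟩ <;> rcases hxy' with ⟨h1, h2⟩ | ⟨h1, h2⟩
    · rw [h1, h2]
    · exact absurd hp'.2 (h1 ▸ hd _ hp.1)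
    · exact absurd hp.2 (hd _ (h1 ▸ hp'.1))
    · rw [h1, h2]
  · exact hw hx'.1

open Classical in
/-- If `Z` contains a unique copy of `K`, no swap of two vertices of this copy gives another one.
Whether this holds for the swaps of `T₁` with `T₂` depends only on the positions of the vertices in
`T₁ ∪ T₂` and their neighbours, which allows for a union bound. -/
theorem card_unique_copy_le_of_sunflower {K : SimpleGraph V} {T₁ T₂ : Finset V}
    (hT : Disjoint T₁ T₂)
    (hind : ∀ u ∈ T₁ ∪ T₂, ∀ v ∈ T₁ ∪ T₂, ¬ K.Adj u v)
    (hsun : ∀ u ∈ T₁ ∪ T₂, ∀ v ∈ T₁ ∪ T₂, ∀ w ∈ T₁ ∪ T₂, v ≠ w →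
      ∀ x, K.Adj v x → K.Adj w x → K.Adj u x)
    {D : ℕ} (hD : ∀ u ∈ T₁ ∪ T₂, K.degree u ≤ D) (hV : 1 ≤ Fintype.card V) :
    ((Finset.univ.filter fun Z : SimpleGraph V => ∃! σ : Equiv.Perm V, K.comap σ ≤ Z).card : ℝ) ≤
      (Fintype.card V : ℝ) ^ ((T₁ ∪ T₂).card * (D + 1)) *
        (2 ^ (Fintype.card V).choose 2 * (1 - (1 / 2) ^ (2 * D)) ^ (T₁.card * T₂.card)) := by
  set T := T₁ ∪ T₂ with hTdef
  -- The swap edges have both ends in `W`.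
  set W := T ∪ T.biUnion fun u => K.neighborFinset u with hW
  have hWcard : W.card ≤ T.card * (D + 1) := by
    calc W.card ≤ T.card + T.card * D := (Finset.card_union_le _ _).trans
          (add_le_add le_rfl (Finset.card_biUnion_le_card_mul _ _ D fun u hu => hD u hu))
      _ = _ := by ring
  set Q : Equiv.Perm V → V × V → Finset (Edge V) :=
    fun τ p => (swapEdges K p.1 p.2).map (edgePerm τ).toEmbedding with hQ
  set B : Equiv.Perm V → Finset (Finset (Edge V)) :=
    fun τ => Finset.univ.filter fun Y => ∀ p ∈ T₁ ×ˢ T₂, ¬ Q τ p ⊆ Y with hB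
  have hmem : ∀ p ∈ T₁ ×ˢ T₂, p.1 ∈ T ∧ p.2 ∈ T := by
    intro p hp
    rw [Finset.mem_product] at hp
    exact ⟨Finset.mem_union_left _ hp.1, Finset.mem_union_right _ hp.2⟩
  have hBcard : ∀ τ, ((B τ).card : ℝ) ≤
      2 ^ (Fintype.card V).choose 2 * (1 - (1 / 2) ^ (2 * D)) ^ (T₁.card * T₂.card) := by
    intro τ
    have h := card_forall_not_subset_le (T₁ ×ˢ T₂) (Q τ) (2 * D)
      (fun p hp => by
        rw [hQ, Finset.card_map]
        exact card_swapEdges_le (hind _ (hmem p hp).1 _ (hmem p hp).2) (hD _ (hmem p hp).1)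
          (hD _ (hmem p hp).2))
      (fun p hp p' hp' hne => by
        rw [hQ, Finset.disjoint_map]
        exact disjoint_swapEdges hT hind hsun hp hp' hne)
    rw [card_edge, Finset.card_product] at h
    convert h
  have hQcongr : ∀ τ τ' : Equiv.Perm V, (∀ x ∈ W, τ x = τ' x) → ∀ p ∈ T₁ ×ˢ T₂,
      Q τ p = Q τ' p := by
    intro τ τ' h p hp
    simp only [hQ, Finset.map_eq_image]
    refine Finset.image_congr fun e he => ?_
    obtain ⟨x, y, w, hxy, hyw, -, hew⟩ :=
      exists_of_mem_swapEdges (hind _ (hmem p hp).1 _ (hmem p hp).2) he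
    have hxT : x ∈ T ∧ y ∈ T := by
      rcases hxy with ⟨rfl, rfl⟩ | ⟨rfl, rfl⟩
      exacts [hmem p hp, (hmem p hp).symm]
    have hwW : w ∈ W := Finset.mem_union_right _
      (Finset.mem_biUnion.2 ⟨y, hxT.2, by simpa using hyw⟩)
    ext1
    simp only [Equiv.coe_toEmbedding, coe_edgePerm, hew, Sym2.map_mk,
      h x (Finset.mem_union_left _ hxT.1), h w hwW]
  set R : Finset (W → V) :=
    (Finset.univ : Finset (Equiv.Perm V)).image fun τ x => τ x.1 with hR
  have hRcard : R.card ≤ Fintype.card V ^ (T.card * (D + 1)) := by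
    refine (Finset.card_le_univ R).trans ?_
    rw [Fintype.card_fun, Fintype.card_coe]
    exact Nat.pow_le_pow_right hV hWcard
  -- One permutation for each of its possible restrictions to `W`.
  have hrep : ∀ r : W → V, ∃ τ : Equiv.Perm V, r ∈ R → ∀ x : W, τ x.1 = r x := by
    intro r
    by_cases hr : r ∈ R
    · obtain ⟨τ, -, rfl⟩ := Finset.mem_image.1 hr
      exact ⟨τ, fun _ _ => rfl⟩
    · exact ⟨1, fun h => absurd h hr⟩
  choose rep hrep using hrep
  have hcover : (Finset.univ.filter fun Z : SimpleGraph V =>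
      ∃! σ : Equiv.Perm V, K.comap σ ≤ Z).card ≤ (R.biUnion fun r => B (rep r)).card := by
    refine Finset.card_le_card_of_injOn edges ?_ edges_injective.injOn
    intro Z hZ
    simp only [Finset.coe_filter, Finset.mem_univ, true_and, Set.mem_ofPred_eq] at hZ
    obtain ⟨σ, hσ, hu⟩ := hZ
    have hr : (fun x : W => σ.symm x.1) ∈ R :=
      Finset.mem_image.2 ⟨σ.symm, Finset.mem_univ _, rfl⟩
    refine Finset.mem_coe.2 (Finset.mem_biUnion.2 ⟨_, hr, ?_⟩)
    simp only [hB, Finset.mem_filter, Finset.mem_univ, true_and]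
    intro p hp hsub
    rw [hQcongr _ σ.symm (fun x hx => hrep _ hr ⟨x, hx⟩) p hp] at hsub
    have hle : K.comap (Equiv.swap p.1 p.2 * σ) ≤ Z := by
      rw [← edges_subset_edges]
      intro e he
      have he' : edgePerm σ e ∈ edges (K.comap (Equiv.swap p.1 p.2)) := by
        rw [edgePerm_mem_edges]
        exact he
      by_cases hK : edgePerm σ e ∈ edges K
      · exact edges_subset_edges.2 hσ (edgePerm_mem_edges.1 hK)
      · exact hsub (Finset.mem_map.2 ⟨edgePerm σ e, Finset.mem_sdiff.2 ⟨he', hK⟩, by simp⟩)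
    have hswap := hu _ hle
    rw [mul_eq_right, Equiv.swap_eq_one_iff] at hswap
    rw [Finset.mem_product] at hp
    exact Finset.disjoint_left.1 hT hp.1 (hswap ▸ hp.2)
  calc _ ≤ ((R.biUnion fun r => B (rep r)).card : ℝ) := Nat.cast_le.2 hcover
    _ ≤ ∑ r ∈ R, ((B (rep r)).card : ℝ) := by exact_mod_cast Finset.card_biUnion_le
    _ ≤ R.card • _ := Finset.sum_le_card_nsmul _ _ _ fun r _ => hBcard (rep r)
    _ ≤ _ := by
      rw [nsmul_eq_mul]
      refine mul_le_mul_of_nonneg_right (by exact_mod_cast hRcard) ?_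
      have : ((1 : ℝ) / 2) ^ (2 * D) ≤ 1 := pow_le_one₀ (by norm_num) (by norm_num)
      have : (0 : ℝ) ≤ 1 - (1 / 2) ^ (2 * D) := by linarith
      positivity

open Classical in
/-- A graph with linearly many edges has many vertices of bounded degree, and the sunflower lemma
for their closed neighbourhoods yields a large independent set as needed for the union bound. -/
theorem card_unique_copy_le_of_sparse (K : SimpleGraph V) (C t : ℕ)
    (hK : (edges K).card ≤ C * Fintype.card V)
    (ht : 2 * ((2 * t + (4 * C + 1)) * (4 * C + 3)) ^ (4 * C + 2) ≤ Fintype.card V) :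
    ((Finset.univ.filter fun Z : SimpleGraph V => ∃! σ : Equiv.Perm V, K.comap σ ≤ Z).card : ℝ) ≤
      (Fintype.card V : ℝ) ^ (2 * t * (4 * C + 1)) *
        (2 ^ (Fintype.card V).choose 2 * (1 - (1 / 2) ^ (2 * (4 * C))) ^ (t * t)) := by
  set S := Finset.univ.filter fun u : V => K.degree u ≤ 4 * C with hS
  have hScard : Fintype.card V ≤ 2 * S.card := by
    have h1 : Sᶜ.card * (4 * C + 1) ≤ 2 * (C * Fintype.card V) := by
      rw [← smul_eq_mul]
      calc Sᶜ.card • (4 * C + 1) ≤ ∑ u ∈ Sᶜ, K.degree u := by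
            refine Finset.card_nsmul_le_sum _ _ _ fun u hu => ?_
            simp only [hS, Finset.mem_compl, Finset.mem_filter, Finset.mem_univ, true_and] at hu
            omega
        _ ≤ ∑ u, K.degree u := Finset.sum_le_sum_of_subset (Finset.subset_univ _)
        _ = 2 * (edges K).card := by
            rw [card_edges, SimpleGraph.sum_degrees_eq_twice_card_edges]
        _ ≤ _ := Nat.mul_le_mul_left _ hK
    have h2 := Finset.card_add_card_compl S
    by_contra h3
    have h4 : Fintype.card V + 1 ≤ 2 * Sᶜ.card := by omega
    nlinarith
  obtain ⟨T, hTS, hTcard, hT⟩ := exists_sunflower (2 * t + (4 * C + 1)) (by omega) (4 * C + 1)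
    (fun u => insert u (K.neighborFinset u)) S (fun u hu => by
      refine (Finset.card_insert_le _ _).trans ?_
      simp only [hS, Finset.mem_filter, Finset.mem_univ, true_and] at hu
      rw [SimpleGraph.card_neighborFinset_eq_degree]
      omega) (by
      rw [show 4 * C + 1 + 2 = 4 * C + 3 by ring, show 4 * C + 1 + 1 = 4 * C + 2 by ring]
      omega)
  -- A vertex of `T` with a neighbour in `T` lies in all closed neighbourhoods.
  set A := T.filter fun u => ∃ v ∈ T, K.Adj u v with hA
  have hAcard : A.card ≤ 4 * C + 1 := by
    obtain ⟨u₀, hu₀⟩ : T.Nonempty := Finset.card_pos.1 (by omega)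
    have hsub : A ⊆ insert u₀ (K.neighborFinset u₀) := by
      intro u hu
      obtain ⟨huT, v, hv, huv⟩ := Finset.mem_filter.1 hu
      exact hT u₀ hu₀ u huT v hv huv.ne (Finset.mem_inter.2 ⟨Finset.mem_insert_self _ _,
        Finset.mem_insert_of_mem (by simpa using huv.symm)⟩)
    refine (Finset.card_le_card hsub).trans ((Finset.card_insert_le _ _).trans ?_)
    have := (Finset.mem_filter.1 (hTS hu₀)).2
    rw [SimpleGraph.card_neighborFinset_eq_degree]
    omega
  have hind : ∀ u ∈ T \ A, ∀ v ∈ T \ A, ¬ K.Adj u v := by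
    intro u hu v hv huv
    rw [Finset.mem_sdiff] at hu hv
    exact hu.2 (Finset.mem_filter.2 ⟨hu.1, v, hv.1, huv⟩)
  have hsun : ∀ u ∈ T \ A, ∀ v ∈ T \ A, ∀ w ∈ T \ A, v ≠ w →
      ∀ x, K.Adj v x → K.Adj w x → K.Adj u x := by
    intro u hu v hv w hw hvw x hvx hwx
    have h := hT u (Finset.mem_sdiff.1 hu).1 v (Finset.mem_sdiff.1 hv).1 w
      (Finset.mem_sdiff.1 hw).1 hvw (Finset.mem_inter.2
        ⟨Finset.mem_insert_of_mem (by simpa using hvx),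
          Finset.mem_insert_of_mem (by simpa using hwx)⟩)
    rw [Finset.mem_insert, SimpleGraph.mem_neighborFinset] at h
    rcases h with rfl | h
    · exact absurd hvx (hind v hv x hu)
    · exact h
  have hcard : t + t ≤ (T \ A).card := by
    have := Finset.le_card_sdiff A T
    omega
  obtain ⟨T₁, hT₁, hT₁c⟩ := Finset.exists_subset_card_eq (show t ≤ (T \ A).card by omega)
  obtain ⟨T₂, hT₂, hT₂c⟩ := Finset.exists_subset_card_eq
    (show t ≤ ((T \ A) \ T₁).card by rw [Finset.card_sdiff_of_subset hT₁]; omega)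
  have hsub : T₁ ∪ T₂ ⊆ T \ A := Finset.union_subset hT₁ (hT₂.trans Finset.sdiff_subset)
  have hdisj : Disjoint T₁ T₂ := (Finset.disjoint_of_subset_left hT₂ Finset.sdiff_disjoint).symm
  have h := card_unique_copy_le_of_sunflower (K := K) hdisj
    (fun u hu v hv => hind u (hsub hu) v (hsub hv))
    (fun u hu v hv w hw => hsun u (hsub hu) v (hsub hv) w (hsub hw)) (D := 4 * C)
    (fun u hu => (Finset.mem_filter.1 (hTS (Finset.mem_sdiff.1 (hsub hu)).1)).2)
    (by
      have : 0 < ((2 * t + (4 * C + 1)) * (4 * C + 3)) ^ (4 * C + 2) := by positivity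
      omega)
  rwa [Finset.card_union_of_disjoint hdisj, hT₁c, hT₂c, ← two_mul] at h

end SparseCase

/-! ### From unique subgraphs to unique embeddings -/

section Reduction

variable {V : Type*}

/-- The image of a subgraph under `σ⁻¹`, provided that its edges lie in `H`. -/
def permSubgraph {H : SimpleGraph V} (S : H.Subgraph) (σ : Equiv.Perm V)
    (h : S.spanningCoe.comap σ ≤ H) : H.Subgraph where
  verts := σ ⁻¹' S.verts
  Adj a b := S.Adj (σ a) (σ b)
  adj_sub hab := h hab
  edge_vert hab := S.edge_vert hab
  symm := ⟨fun _ _ hab => hab.symm⟩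

/-- The image of a subgraph under `σ⁻¹` is isomorphic to it. -/
def permSubgraphIso {H : SimpleGraph V} (S : H.Subgraph) (σ : Equiv.Perm V)
    (h : S.spanningCoe.comap σ ≤ H) : (permSubgraph S σ h).coe ≃g S.coe where
  toEquiv := σ.subtypeEquiv fun _ => Iff.rfl
  map_rel_iff' := Iff.rfl

/-- A non-spanning subgraph that is unique up to isomorphism has no isolated vertices: such a
vertex could be replaced by any vertex outside of the subgraph. -/
theorem verts_eq_support_of_unique [DecidableEq V] {H : SimpleGraph V} {S : H.Subgraph}
    (hS : ∀ S' : H.Subgraph, Nonempty (S'.coe ≃g S.coe) → S' = S) (hne : S.verts ≠ Set.univ) :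
    S.verts = S.support := by
  refine Set.Subset.antisymm ?_ S.support_subset_verts
  intro v hv
  by_contra hsupp
  have hv' : ∀ w, ¬ S.Adj v w := fun w h => hsupp ⟨w, h⟩
  obtain ⟨w, hw⟩ := (Set.ne_univ_iff_exists_notMem _).1 hne
  have hw' : ∀ x, ¬ S.Adj w x := fun x h => hw (S.edge_vert h)
  have hle : S.spanningCoe.comap (Equiv.swap v w) ≤ H := by
    intro a b hab
    simp only [SimpleGraph.comap_adj, SimpleGraph.Subgraph.spanningCoe_adj] at hab
    have hiso : ∀ a b, S.Adj (Equiv.swap v w a) b → Equiv.swap v w a = a := by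
      intro a b h
      refine Equiv.swap_apply_of_ne_of_ne ?_ ?_
      · rintro rfl
        rw [Equiv.swap_apply_left] at h
        exact hw' _ h
      · rintro rfl
        rw [Equiv.swap_apply_right] at h
        exact hv' _ h
    rw [← hiso a _ hab, ← hiso b _ hab.symm]
    exact S.adj_sub hab
  have h := hS _ ⟨permSubgraphIso S _ hle⟩
  have hmem : w ∈ (permSubgraph S _ hle).verts := by
    change Equiv.swap v w w ∈ S.verts
    rwa [Equiv.swap_apply_right]
  rw [h] at hmem
  exact hw hmem

/-- `X` is a spanning subgraph of `H`, and the only one isomorphic to it. -/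
def IsUniqueSpanning (X H : SimpleGraph V) : Prop :=
  X ≤ H ∧ ∀ σ : Equiv.Perm V, X.comap σ ≤ H → X.comap σ = X

/-- A unique subgraph becomes a unique spanning subgraph when the missing vertices are added as
isolated ones. Conversely, the unique subgraph is recovered from this spanning subgraph and from
whether it was spanning itself. -/
theorem ncard_uniqueClasses_le [Fintype V] [DecidableEq V] (H : SimpleGraph V)
    [DecidablePred fun X => IsUniqueSpanning X H] :
    (uniqueClasses H).ncard ≤
      2 * (Finset.univ.filter fun X : SimpleGraph V => IsUniqueSpanning X H).card := by
  classical
  have key : ∀ c : IsoClass, ∃ S : H.Subgraph, c ∈ uniqueClasses H →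
      (∃ G : FinGraph, Quotient.mk isoSetoid G = c ∧ Nonempty (G.2 ≃g S.coe)) ∧
        ∀ S' : H.Subgraph, Nonempty (S'.coe ≃g S.coe) → S' = S := by
    intro c
    by_cases hc : c ∈ uniqueClasses H
    · obtain ⟨G, hG, S, ⟨e⟩, hu⟩ := hc
      refine ⟨S, fun _ => ⟨⟨G, hG, ⟨e⟩⟩, ?_⟩⟩
      rintro S' ⟨e'⟩
      exact hu S' ⟨e'.symm.comp e⟩
    · exact ⟨⊥, fun h => absurd h hc⟩
  choose S hS using key
  rw [Set.ncard_eq_toFinset_card _ (uniqueClasses_finite H), mul_comm, ← Fintype.card_bool,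
    ← Finset.card_univ (α := Bool), ← Finset.card_product]
  refine Finset.card_le_card_of_injOn
    (fun c => ((S c).spanningCoe, decide ((S c).verts = Set.univ))) ?_ ?_
  · intro c hc
    rw [Set.Finite.coe_toFinset] at hc
    obtain ⟨-, hu⟩ := hS c hc
    simp only [Finset.coe_product, Finset.coe_filter, Finset.mem_univ, true_and, Finset.coe_univ,
      Set.mem_prod, Set.mem_ofPred_eq, Set.mem_univ, and_true]
    refine ⟨(S c).spanningCoe_le, fun σ hσ => ?_⟩
    have h := hu _ ⟨permSubgraphIso (S c) σ hσ⟩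
    ext a b
    exact iff_of_eq (congrArg (fun T : H.Subgraph => T.Adj a b) h)
  · intro c hc c' hc' h
    rw [Set.Finite.coe_toFinset] at hc hc'
    obtain ⟨⟨G, hG, ⟨e⟩⟩, hu⟩ := hS c hc
    obtain ⟨⟨G', hG', ⟨e'⟩⟩, hu'⟩ := hS c' hc'
    simp only [Prod.mk.injEq, decide_eq_decide] at h
    obtain ⟨h1, h2⟩ := h
    have hadj : (S c).Adj = (S c').Adj := by
      funext a b
      exact congrArg (fun X : SimpleGraph V => X.Adj a b) h1
    have hverts : (S c).verts = (S c').verts := by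
      by_cases hc : (S c).verts = Set.univ
      · rw [hc, h2.1 hc]
      · rw [verts_eq_support_of_unique hu hc,
          verts_eq_support_of_unique hu' (fun h => hc (h2.2 h))]
        ext v
        simp only [SimpleGraph.Subgraph.mem_support, hadj]
    have hSS : S c = S c' := SimpleGraph.Subgraph.ext hverts hadj
    rw [← hSS] at e'
    rw [← hG, ← hG']
    exact Quotient.sound ⟨e'.symm.comp e⟩

theorem IsUniqueSpanning.eq_of_comap_eq {H X X' : SimpleGraph V} (hX : IsUniqueSpanning X H)
    (hX' : X' ≤ H) {σ : Equiv.Perm V} (h : X.comap σ = X') : X = X' := by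
  rw [← h, hX.2 σ (h ▸ hX')]

open Classical in
/-- By the orbit-stabilizer theorem, each unique spanning subgraph accounts for `n!` pairs of a
labelled graph isomorphic to it and an automorphism of that graph; and such a labelled graph has a
unique embedding into `H` unless it has nontrivial automorphisms. -/
theorem factorial_mul_card_isUniqueSpanning_le [Fintype V] [DecidableEq V]
    (H : SimpleGraph V) :
    (Fintype.card V).factorial *
      (Finset.univ.filter fun X : SimpleGraph V => IsUniqueSpanning X H).card ≤
      (Finset.univ.filter fun Y : SimpleGraph V => ∃! σ : Equiv.Perm V, Y.comap σ ≤ H).card +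
        2 * ∑ π ∈ (Finset.univ : Finset (Equiv.Perm V)).erase 1,
          (Finset.univ.filter fun X : SimpleGraph V => X.comap π = X).card := by
  set P := Finset.univ.filter fun X : SimpleGraph V => IsUniqueSpanning X H with hP
  set O := Finset.univ.filter fun Y : SimpleGraph V =>
    ∃ σ : Equiv.Perm V, IsUniqueSpanning (Y.comap σ) H with hO
  have hcomp : ∀ (Y : SimpleGraph V) (σ τ : Equiv.Perm V),
      (Y.comap σ).comap τ = Y.comap (σ * τ : Equiv.Perm V) := fun _ _ _ => rfl
  have hone : ∀ Y : SimpleGraph V, Y.comap (1 : Equiv.Perm V) = Y := fun _ => rfl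
  have hg : ∀ Y : SimpleGraph V, ∃ σ : Equiv.Perm V, Y ∈ O → IsUniqueSpanning (Y.comap σ) H := by
    intro Y
    by_cases hY : Y ∈ O
    · obtain ⟨σ, hσ⟩ := (Finset.mem_filter.1 hY).2
      exact ⟨σ, fun _ => hσ⟩
    · exact ⟨1, fun h => absurd h hY⟩
  -- `g Y` takes `Y` back to the unique spanning subgraph isomorphic to it.
  choose g hg using hg
  have hPO : ∀ X ∈ P, ∀ σ : Equiv.Perm V, X.comap σ ∈ O := by
    intro X hX σ
    refine Finset.mem_filter.2 ⟨Finset.mem_univ _, σ⁻¹, ?_⟩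
    rw [hcomp, mul_inv_cancel, hone]
    exact (Finset.mem_filter.1 hX).2
  have hback : ∀ X ∈ P, ∀ σ : Equiv.Perm V, (X.comap σ).comap (g (X.comap σ)) = X := by
    intro X hX σ
    exact ((Finset.mem_filter.1 hX).2.eq_of_comap_eq (hg _ (hPO X hX σ)).1
      (σ := σ * g (X.comap σ)) rfl).symm
  have h1 : (Fintype.card V).factorial * P.card ≤
      ∑ π : Equiv.Perm V, (O.filter fun Y => Y.comap π = Y).card := by
    rw [← Fintype.card_perm, ← Finset.card_univ, ← Finset.card_product, ← Finset.card_sigma]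
    refine Finset.card_le_card_of_injOn
      (fun p => ⟨g (p.2.comap p.1) * p.1, p.2.comap p.1⟩) ?_ ?_
    · rintro ⟨σ, X⟩ h
      have hX := (Finset.mem_product.1 (Finset.mem_coe.1 h)).2
      refine Finset.mem_coe.2 (Finset.mem_sigma.2 ⟨Finset.mem_univ _, Finset.mem_filter.2
        ⟨hPO X hX σ, ?_⟩⟩)
      dsimp only
      rw [← hcomp, hback X hX]
    · rintro ⟨σ, X⟩ h ⟨σ', X'⟩ h' heq
      have hX := (Finset.mem_product.1 (Finset.mem_coe.1 h)).2
      have hX' := (Finset.mem_product.1 (Finset.mem_coe.1 h')).2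
      simp only [Sigma.mk.injEq, heq_eq_eq] at heq
      obtain ⟨h2, h3⟩ := heq
      have hXX : X = X' := by
        have h4 := hback X hX σ
        have h5 := hback X' hX' σ'
        rw [← h4, ← h5, h3]
      rw [h3, mul_right_inj] at h2
      rw [h2, hXX]
  set A := Finset.univ.filter fun Y : SimpleGraph V => ∃! σ : Equiv.Perm V, Y.comap σ ≤ H
  set Fix : Equiv.Perm V → Finset (SimpleGraph V) :=
    fun π => Finset.univ.filter fun X => X.comap π = X with hFix
  have h2 : O ⊆ A ∪ (Finset.univ.erase 1).biUnion Fix := by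
    intro Y hY
    by_cases hfix : ∃ π : Equiv.Perm V, π ≠ 1 ∧ Y.comap π = Y
    · obtain ⟨π, hπ, hY⟩ := hfix
      exact Finset.mem_union_right _ (Finset.mem_biUnion.2
        ⟨π, by simp [hπ], by simpa [hFix] using hY⟩)
    · push Not at hfix
      refine Finset.mem_union_left _ (Finset.mem_filter.2 ⟨Finset.mem_univ _, g Y,
        (hg Y hY).1, fun σ hσ => ?_⟩)
      dsimp only at hσ
      by_contra hne
      refine hfix (σ * (g Y)⁻¹) (by rwa [Ne, mul_inv_eq_one]) ?_
      have h3 : Y.comap σ = Y.comap (g Y) := by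
        have h4 := (hg Y hY).2 ((g Y)⁻¹ * σ)
        rw [hcomp, mul_inv_cancel_left] at h4
        exact h4 hσ
      rw [← hcomp, h3, hcomp, mul_inv_cancel, hone]
  have h3 : O.card ≤ A.card + ∑ π ∈ Finset.univ.erase 1, (Fix π).card :=
    (Finset.card_le_card h2).trans ((Finset.card_union_le _ _).trans
      (add_le_add le_rfl Finset.card_biUnion_le))
  have h4 : ∑ π : Equiv.Perm V, (O.filter fun Y => Y.comap π = Y).card ≤
      O.card + ∑ π ∈ Finset.univ.erase 1, (Fix π).card := by
    rw [← Finset.add_sum_erase _ _ (Finset.mem_univ (1 : Equiv.Perm V))]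
    exact add_le_add (Finset.card_filter_le _ _) (Finset.sum_le_sum fun π _ =>
      Finset.card_le_card (Finset.filter_subset_filter _ (Finset.subset_univ _)))
  change _ ≤ A.card + 2 * ∑ π ∈ Finset.univ.erase 1, (Fix π).card
  omega

open Classical in
/-- In terms of complements, an embedding of `Y` into `H` is a copy of `Hᶜ` in `Yᶜ`. -/
theorem card_unique_embedding_le [Fintype V] [DecidableEq V] (H : SimpleGraph V) :
    (Finset.univ.filter fun Y : SimpleGraph V => ∃! σ : Equiv.Perm V, Y.comap σ ≤ H).card ≤
      (Finset.univ.filter fun Z : SimpleGraph V =>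
        ∃! σ : Equiv.Perm V, Hᶜ.comap σ ≤ Z).card := by
  refine Finset.card_le_card_of_injOn compl ?_ compl_injective.injOn
  intro Y hY
  simp only [Finset.coe_filter, Finset.mem_univ, true_and, Set.mem_ofPred_eq] at hY ⊢
  have key : ∀ σ : Equiv.Perm V, Hᶜ.comap σ ≤ Yᶜ ↔ Y.comap (σ⁻¹ : Equiv.Perm V) ≤ H := by
    intro σ
    constructor
    · intro h a b hab
      by_contra hH
      have hne : a ≠ b := fun h => Y.ne_of_adj hab (h ▸ rfl)
      have := @h (σ⁻¹ a) (σ⁻¹ b) (by simpa [SimpleGraph.compl_adj] using ⟨hne, hH⟩)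
      exact ((SimpleGraph.compl_adj _ _ _).1 this).2 hab
    · intro h a b hab
      rw [SimpleGraph.comap_adj, SimpleGraph.compl_adj] at hab
      refine (SimpleGraph.compl_adj _ _ _).2 ⟨fun h => hab.1 (h ▸ rfl), fun hY => hab.2 (h ?_)⟩
      simpa using hY
  obtain ⟨σ, hσ, hu⟩ := hY
  refine ⟨σ⁻¹, (key _).2 (by simpa using hσ), fun τ hτ => ?_⟩
  rw [← hu _ ((key τ).1 hτ), inv_inv]

end Reduction

/-! ### Asymptotics -/

section Asymptotics

theorem tendsto_nat_log_atTop {b : ℕ} (hb : 1 < b) : Tendsto (Nat.log b) atTop atTop :=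
  tendsto_atTop_atTop.2 fun k => ⟨b ^ k, fun _ hn => Nat.le_log_of_pow_le hb hn⟩

/-- The number of labelled graphs with a nontrivial automorphism is negligible. -/
theorem tendsto_automorphism_bound :
    Tendsto (fun n : ℕ => (1 + (n : ℝ) * (2 : ℝ) ^ (-(((n - 2 : ℕ) : ℝ) / 6))) ^ n - 1)
      atTop (𝓝 0) := by
  set r : ℝ := (2 : ℝ) ^ (-(1 / 6) : ℝ) with hr
  have hr0 : 0 < r := by positivity
  have hr1 : r < 1 := Real.rpow_lt_one_of_one_lt_of_neg (by norm_num) (by norm_num)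
  have h1 : Tendsto (fun n : ℕ => Real.exp (2 * ((n : ℝ) ^ 2 * r ^ n)) - 1) atTop (𝓝 0) := by
    have h2 : Tendsto (fun n : ℕ => (n : ℝ) ^ 2 * r ^ n) atTop (𝓝 0) :=
      tendsto_pow_const_mul_const_pow_of_abs_lt_one 2 (by rwa [abs_of_pos hr0])
    have h3 := (Real.continuous_exp.tendsto _).comp (h2.const_mul 2)
    simpa using h3.sub_const 1
  refine squeeze_zero (fun n => ?_) (fun n => ?_) h1
  · have : (1 : ℝ) ≤ (1 + (n : ℝ) * (2 : ℝ) ^ (-(((n - 2 : ℕ) : ℝ) / 6))) ^ n :=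
      one_le_pow₀ (le_add_of_nonneg_right (by positivity))
    linarith
  · have hq : (2 : ℝ) ^ (-(((n - 2 : ℕ) : ℝ) / 6)) ≤ 2 * r ^ n := by
      rw [hr, ← Real.rpow_mul_natCast (by norm_num)]
      nth_rewrite 2 [← Real.rpow_one 2]
      rw [← Real.rpow_add (by norm_num)]
      refine Real.rpow_le_rpow_of_exponent_le (by norm_num) ?_
      have : (n : ℝ) ≤ ((n - 2 : ℕ) : ℝ) + 2 := by exact_mod_cast (by omega : n ≤ n - 2 + 2)
      linarith
    have h4 : (1 + (n : ℝ) * (2 : ℝ) ^ (-(((n - 2 : ℕ) : ℝ) / 6))) ^ n ≤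
        Real.exp (2 * ((n : ℝ) ^ 2 * r ^ n)) := by
      calc (1 + (n : ℝ) * (2 : ℝ) ^ (-(((n - 2 : ℕ) : ℝ) / 6))) ^ n
          ≤ Real.exp (n * (2 * r ^ n)) ^ n := by
            refine pow_le_pow_left₀ (by positivity) ?_ n
            rw [add_comm]
            exact (Real.add_one_le_exp _).trans (Real.exp_le_exp.2
              (mul_le_mul_of_nonneg_left hq (by positivity)))
        _ = _ := by
            rw [← Real.exp_nat_mul]
            congr 1
            ring
    linarith

/-- With `t = (log₂ n)²`, the union bound over `n ^ O(t)` partial embeddings is beaten by the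
`t ^ 2` independent swaps. -/
theorem tendsto_swap_bound (C : ℕ) :
    Tendsto (fun n : ℕ => (n : ℝ) ^ (2 * Nat.log 2 n ^ 2 * (4 * C + 1)) *
      (1 - (1 / 2 : ℝ) ^ (2 * (4 * C))) ^ (Nat.log 2 n ^ 2 * Nat.log 2 n ^ 2)) atTop (𝓝 0) := by
  set p : ℝ := 1 - (1 / 2 : ℝ) ^ (2 * (4 * C)) with hp
  have hp0 : 0 ≤ p := by
    have : ((1 : ℝ) / 2) ^ (2 * (4 * C)) ≤ 1 := pow_le_one₀ (by norm_num) (by norm_num)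
    linarith
  have hp1 : p < 1 := by
    have : (0 : ℝ) < (1 / 2) ^ (2 * (4 * C)) := by positivity
    linarith
  have hlog := tendsto_nat_log_atTop (b := 2) (by norm_num)
  have hsmall : ∀ᶠ n : ℕ in atTop, p ^ Nat.log 2 n < (1 / 2) ^ (4 * (4 * C + 1) + 1) :=
    ((tendsto_pow_atTop_nhds_zero_of_lt_one hp0 hp1).comp hlog).eventually_lt_const (by positivity)
  have hlim : Tendsto (fun n : ℕ => (1 / 2 : ℝ) ^ Nat.log 2 n) atTop (𝓝 0) :=
    (tendsto_pow_atTop_nhds_zero_of_lt_one (by norm_num) (by norm_num)).comp hlog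
  refine squeeze_zero' (Eventually.of_forall fun n => by positivity) ?_ hlim
  filter_upwards [hsmall, hlog.eventually_ge_atTop 1] with n hn hr
  set r := Nat.log 2 n with hrdef
  have hn2 : (n : ℝ) ≤ 2 ^ (2 * r) := by
    have h1 : n < 2 ^ (r + 1) := Nat.lt_pow_succ_log_self (by norm_num) n
    have h2 : 2 ^ (r + 1) ≤ 2 ^ (2 * r) := Nat.pow_le_pow_right (by norm_num) (by omega)
    exact_mod_cast h1.le.trans h2
  calc (n : ℝ) ^ (2 * r ^ 2 * (4 * C + 1)) * p ^ (r ^ 2 * r ^ 2)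
      ≤ (2 ^ (2 * r)) ^ (2 * r ^ 2 * (4 * C + 1)) * ((1 / 2) ^ (4 * (4 * C + 1) + 1)) ^ r ^ 3 := by
        refine mul_le_mul (pow_le_pow_left₀ (by positivity) hn2 _) ?_ (by positivity)
          (by positivity)
        rw [show r ^ 2 * r ^ 2 = r * r ^ 3 by ring, pow_mul]
        exact pow_le_pow_left₀ (by positivity) hn.le _
    _ = (1 / 2) ^ r ^ 3 := by
        rw [← pow_mul, ← pow_mul, add_mul, one_mul, pow_add,
          show 2 * r * (2 * r ^ 2 * (4 * C + 1)) = 4 * (4 * C + 1) * r ^ 3 by ring, ← mul_assoc,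
          ← mul_pow]
        norm_num
    _ ≤ (1 / 2) ^ r :=
        pow_le_pow_of_le_one (by norm_num) (by norm_num) (Nat.le_self_pow (by norm_num) r)

/-- The number of vertices needed for the sunflower lemma is polylogarithmic. -/
theorem eventually_sunflower_bound_le (C : ℕ) :
    ∀ᶠ n : ℕ in atTop,
      2 * ((2 * Nat.log 2 n ^ 2 + (4 * C + 1)) * (4 * C + 3)) ^ (4 * C + 2) ≤ n := by
  have hlog := tendsto_nat_log_atTop (b := 2) (by norm_num)
  set c : ℕ := 2 * ((4 * C + 3) * (4 * C + 3)) ^ (4 * C + 2) with hc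
  have h1 : Tendsto (fun r : ℕ => (r : ℝ) ^ (2 * (4 * C + 2)) / 2 ^ r) atTop (𝓝 0) :=
    tendsto_pow_const_div_const_pow_of_one_lt _ (by norm_num)
  have h2 : ∀ᶠ r : ℕ in atTop, (r : ℝ) ^ (2 * (4 * C + 2)) / 2 ^ r < 1 / c :=
    h1.eventually_lt_const (by positivity)
  filter_upwards [hlog.eventually h2, hlog.eventually_ge_atTop 1, eventually_ge_atTop 1]
    with n hn hr hn1
  set r := Nat.log 2 n with hrdef
  rw [div_lt_div_iff₀ (by positivity) (by positivity), one_mul] at hn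
  have h3 : r ^ (2 * (4 * C + 2)) * c < 2 ^ r := by exact_mod_cast hn
  have h4 : 2 ^ r ≤ n := Nat.pow_log_le_self 2 (by omega)
  refine le_trans ?_ (h3.le.trans h4)
  have h5 : (2 * r ^ 2 + (4 * C + 1)) * (4 * C + 3) ≤ r ^ 2 * ((4 * C + 3) * (4 * C + 3)) := by
    rw [← mul_assoc]
    refine Nat.mul_le_mul_right _ ?_
    have : 1 ≤ r ^ 2 := Nat.one_le_pow _ _ hr
    nlinarith
  calc _ ≤ 2 * (r ^ 2 * ((4 * C + 3) * (4 * C + 3))) ^ (4 * C + 2) :=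
        Nat.mul_le_mul_left _ (Nat.pow_le_pow_left h5 _)
    _ = _ := by rw [mul_pow, ← pow_mul, hc]; ring

open Classical in
/-- A random graph contains a unique copy of a given spanning graph with small probability. -/
theorem eventually_card_unique_copy_le {ε : ℝ} (hε : 0 < ε) :
    ∀ᶠ n : ℕ in atTop, ∀ K : SimpleGraph (Fin n),
      ((Finset.univ.filter fun Z : SimpleGraph (Fin n) =>
        ∃! σ : Equiv.Perm (Fin n), K.comap σ ≤ Z).card : ℝ) ≤ ε * 2 ^ n.choose 2 := by
  obtain ⟨C, hC⟩ := exists_nat_gt (1 / ε)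
  have hC0 : (0 : ℝ) < C := lt_trans (by positivity) hC
  filter_upwards [(tendsto_swap_bound C).eventually_lt_const hε, eventually_sunflower_bound_le C,
    eventually_gt_atTop 0] with n hswap hsun hn K
  have hn0 : (0 : ℝ) < n := Nat.cast_pos.2 hn
  -- Sparse graphs are handled by swaps, the others by the influence bound `n / m ≤ 1 / C < ε`.
  rcases le_total (edges K).card (C * n) with hK | hK
  · have h := card_unique_copy_le_of_sparse K C (Nat.log 2 n ^ 2)
      (by rwa [Fintype.card_fin]) (by rwa [Fintype.card_fin])
    rw [Fintype.card_fin] at h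
    refine h.trans ?_
    rw [mul_left_comm, mul_comm ε]
    exact mul_le_mul_of_nonneg_left hswap.le (by positivity)
  · have h := mul_card_unique_copy_le K
    rw [Fintype.card_fin] at h
    have hsqrt : √((n.choose 2 : ℕ) : ℝ) ≤ n := by
      rw [Real.sqrt_le_left (by positivity)]
      exact_mod_cast Nat.choose_le_pow n 2
    have hK' : (C : ℝ) * n ≤ (edges K).card := by exact_mod_cast hK
    set a := ((Finset.univ.filter fun Z : SimpleGraph (Fin n) =>
        ∃! σ : Equiv.Perm (Fin n), K.comap σ ≤ Z).card : ℝ)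
    have h1 : (C : ℝ) * n * a ≤ 2 ^ n.choose 2 * n :=
      (mul_le_mul_of_nonneg_right hK' (by positivity)).trans
        (h.trans (mul_le_mul_of_nonneg_left hsqrt (by positivity)))
    have h2 : (C : ℝ) * a ≤ 2 ^ n.choose 2 :=
      le_of_mul_le_mul_right (by linarith) hn0
    have h3 : 1 ≤ ε * C := by
      rw [div_lt_iff₀ hε] at hC
      linarith
    calc a ≤ ε * C * a := le_mul_of_one_le_left (by positivity) h3
      _ = ε * (C * a) := by ring
      _ ≤ _ := mul_le_mul_of_nonneg_left h2 hε.le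

open Classical in
theorem ratio_le {n : ℕ} (H : SimpleGraph (Fin n)) {ε : ℝ}
    (h : ((Finset.univ.filter fun Z : SimpleGraph (Fin n) =>
      ∃! σ : Equiv.Perm (Fin n), Hᶜ.comap σ ≤ Z).card : ℝ) ≤ ε * 2 ^ n.choose 2) :
    ratio H ≤ 2 * (ε + 2 *
      ((1 + (n : ℝ) * (2 : ℝ) ^ (-(((n - 2 : ℕ) : ℝ) / 6))) ^ n - 1)) := by
  set d := (1 + (n : ℝ) * (2 : ℝ) ^ (-(((n - 2 : ℕ) : ℝ) / 6))) ^ n - 1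
  have h1 := ncard_uniqueClasses_le H
  have h2 := factorial_mul_card_isUniqueSpanning_le H
  have h3 := card_unique_embedding_le H
  have h4 := sum_card_automorphism_le (V := Fin n)
  rw [Fintype.card_fin] at h2 h4
  set P := (Finset.univ.filter fun X : SimpleGraph (Fin n) => IsUniqueSpanning X H).card
  have h1' : ((uniqueClasses H).ncard : ℝ) ≤ 2 * P := by exact_mod_cast h1
  have h2' := Nat.cast_le (α := ℝ).2 h2
  push_cast at h2'
  have h3' := Nat.cast_le (α := ℝ).2 h3
  rw [ratio, div_div_eq_mul_div, div_le_iff₀ (by positivity)]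
  calc ((uniqueClasses H).ncard : ℝ) * n.factorial ≤ 2 * P * n.factorial :=
        mul_le_mul_of_nonneg_right h1' (by positivity)
    _ = 2 * (n.factorial * P) := by ring
    _ ≤ 2 * (ε * 2 ^ n.choose 2 + 2 * (2 ^ n.choose 2 * d)) := by linarith
    _ = _ := by ring

end Asymptotics

end UniqueSubgraph

theorem theorem2 : Tendsto UniqueSubgraph.maxRatio atTop (𝓝 0) := by
  refine tendsto_order.2 ⟨fun a ha => Eventually.of_forall fun n => ?_, fun ε hε => ?_⟩
  · refine ha.trans_le (le_trans ?_ (Finset.le_sup' _ (Finset.mem_univ ⊥)))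
    unfold UniqueSubgraph.ratio
    positivity
  · filter_upwards [UniqueSubgraph.eventually_card_unique_copy_le (show 0 < ε / 8 by positivity),
      UniqueSubgraph.tendsto_automorphism_bound.eventually_lt_const
        (show 0 < ε / 8 by positivity)] with n h1 h2
    refine (Finset.sup'_lt_iff _).2 fun H _ => ?_
    have := UniqueSubgraph.ratio_le H (h1 Hᶜ)
    linarith
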